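/- Let $a,b,c$ be positive integers and consider the hexagon with side lengths $a,b,c,a,b,c$ and all angles $120^\circ$, drawn in the triangular lattice with two vertical sides, namely those of length $c$. Use the oblique coordinate system whose origin is the vertex of the hexagon at the lower end of the left vertical side, whose $y$-axis runs vertically upwards along that side (of length $c$), and whose $x$-axis runs to the lower right along the adjacent side (of length $b$), with both basis vectors of unit length. In these coordinates the hexagon has vertices $(0,0),(b,0),(a+b,a),(a+b,a+c),(a,a+c),(0,c)$ and centre $S=\left(\frac{a+b}{2},\frac{a+c}{2}\right)$. A lozenge is the union of two unit lattice triangles sharing an edge, and a lozenge tiling is a set of lozenges contained in the hexagon that covers every unit triangle of the hexagon exactly once. The horizontal lozenge with lowest vertex $(x,y)$ is the one with vertices $(x,y),(x+1,y+1),(x,y+1),(x-1,y)$. Let $P_{a,b,c}(x,y)$ be the probability that a uniformly random lozenge tiling of the hexagon contains the horizontal lozenge with lowest vertex $(x,y)$. Then the horizontal moment of inertia with respect to $S$ is $$\sum_{x=1}^{a+b-1}\sum_{y=0}^{a+c-1}P_{a,b,c}(x,y)\left(x-\frac{a+b}{2}\right)^2=\frac{1}{12}\,ab\,(a^2+b^2-2),$$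 and the vertical moment of inertia with respect to $S$ is $$\sum_{y=0}^{a+c-1}\sum_{x=1}^{a+b-1}P_{a,b,c}(x,y)\left(2\left(y-\frac{a+c-1}{2}\right)-\left(x-\frac{a+b}{2}\right)\right)^2=\frac{1}{12}\,ab\,(a^2+b^2-2+4c^2+4ac+4bc).$$ -/

import Mathlib

namespace LozengeTiling

/-- A unit triangle of the triangular lattice. Lattice points are written in the oblique
coordinate system whose `y`-axis points vertically upwards and whose `x`-axis points to the lower
right, at an angle of `120` degrees with the `y`-axis; both basis vectors have length one, and
`(1, 1)` is then the third lattice direction of unit length (pointing to the upper right). The unit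
parallelogram with corners `(i, j)`, `(i + 1, j)`, `(i, j + 1)`, `(i + 1, j + 1)` is cut by its short
diagonal from `(i, j)` to `(i + 1, j + 1)` into the two unit triangles `(i, j, true)`, the one above
the diagonal, and `(i, j, false)`, the one below it. -/
abbrev Tri : Type := ℤ × ℤ × Bool

/-- The three vertices of a unit triangle, in oblique coordinates. -/
def Tri.vertices : Tri → Finset (ℤ × ℤ)
  | (i, j, true) => {(i, j), (i, j + 1), (i + 1, j + 1)}
  | (i, j, false) => {(i, j), (i + 1, j), (i + 1, j + 1)}

/-- The lattice points of the hexagon with angles of `120` degrees and side lengths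
`a, b, c, a, b, c`, that is the convex hexagon with vertices
`(0, 0)`, `(b, 0)`, `(a + b, a)`, `(a + b, a + c)`, `(a, a + c)`, `(0, c)`
in oblique coordinates; its centre is `((a + b) / 2, (a + c) / 2)`. -/
def InHexagon (a b c : ℕ) (p : ℤ × ℤ) : Prop :=
  0 ≤ p.1 ∧ p.1 ≤ a + b ∧ 0 ≤ p.2 ∧ p.2 ≤ a + c ∧ -(b : ℤ) ≤ p.2 - p.1 ∧ p.2 - p.1 ≤ c

instance (a b c : ℕ) (p : ℤ × ℤ) : Decidable (InHexagon a b c p) := by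
  unfold InHexagon; infer_instance

/-- The unit triangles contained in the hexagon, i.e. (the hexagon being convex) those whose three
vertices lie in it. The product only serves to enumerate finitely many candidates: for a triangle
`(i, j, _)` in the hexagon its vertex `(i, j)` lies in this range. -/
noncomputable def hexagon (a b c : ℕ) : Finset Tri :=
  (Finset.Icc (0 : ℤ) (a + b) ×ˢ Finset.Icc (0 : ℤ) (a + c) ×ˢ (Finset.univ : Finset Bool)).filter
    (fun t => ∀ p ∈ Tri.vertices t, InHexagon a b c p)

/-- The lozenges contained in the hexagon: unions of two unit triangles that share an edge, i.e.
have exactly two vertices in common. A lozenge is recorded as the set of its two triangles. -/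
noncomputable def lozenges (a b c : ℕ) : Finset (Finset Tri) :=
  ((hexagon a b c ×ˢ hexagon a b c).filter
    (fun q => (Tri.vertices q.1 ∩ Tri.vertices q.2).card = 2)).image (fun q => {q.1, q.2})

/-- The lozenge tilings of the hexagon: the sets of lozenges in the hexagon such that every unit
triangle of the hexagon is covered by exactly one lozenge of the set. -/
noncomputable def tilings (a b c : ℕ) : Finset (Finset (Finset Tri)) :=
  (lozenges a b c).powerset.filter
    (fun T => ∀ t ∈ hexagon a b c, (T.filter (fun l => t ∈ l)).card = 1)

/-- The horizontal lozenge with lowest vertex `(x, y)`: its vertices are `(x, y)`, `(x + 1, y + 1)`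
(right), `(x, y + 1)` (top), `(x - 1, y)` (left), and its two triangles share the vertical edge from
`(x, y)` to `(x, y + 1)`, its short diagonal. -/
def horizontalLozenge (x y : ℤ) : Finset Tri :=
  {(x - 1, y, false), (x, y, true)}

/-- The probability that a uniformly random lozenge tiling of the hexagon contains the horizontal
lozenge with lowest vertex `(x, y)`. -/
noncomputable def P (a b c : ℕ) (x y : ℤ) : ℝ :=
  (((tilings a b c).filter (fun T => horizontalLozenge x y ∈ T)).card : ℝ) /
    ((tilings a b c).card : ℝ)

end LozengeTiling

/-! Record the horizontal lozenges of a tiling along the vertical lines x = 0, …, a + b. Adding the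
lozenges forced in two corner triangles, which complete the hexagon to a trapezoid, puts exactly x
positions on line x, and the positions on neighbouring lines interlace. This is a bijection between
tilings and Gelfand–Tsetlin patterns with top row `topRow` (`rows_mem_patterns`,
`subset_of_rows_eq`, `rows_tilingOf`). Both moments thus become sums over patterns of power sums of
degree at most 2 of the rows, minus explicit contributions of the forced positions (`sum_P_mul`).

The patterns with top row l number det (l i choose j) (`card_patterns`). Multiplying such a
determinant by a power sum of degree 1 or 2 yields determinants with raised exponents, and for the
exponents 0, …, n - 1 only the shapes (1), (2) and (1, 1) survive besides the original. Summation
over interlacing rows preserves each shape (`sum_interlacing_chooseDet`). Hence the power sums of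
row k, summed over all patterns, combine four determinants of the top row with coefficients that are
polynomials in k alone (`sum_patterns_sum_row`, `sum_patterns_sum_sq_row`).

None of the four determinants has to be evaluated: the ratios of the three raised ones to the
original satisfy linear equations given by the first two power sums of the top row. What remains is
summation of polynomials (`sum_sum_P_mul_sq`). -/

namespace LozengeTiling

open Finset

/-! ### Binomial polynomials -/

/-- The binomial coefficient `y choose d` as a polynomial function of `y`. -/
noncomputable def chooseReal : ℕ → ℝ → ℝ
  | 0, _ => 1
  | d + 1, y => chooseReal d y * (y - d) / (d + 1)

lemma mul_chooseReal (d : ℕ) (y : ℝ) :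
    y * chooseReal d y = (d + 1) * chooseReal (d + 1) y + d * chooseReal d y := by
  have : (d : ℝ) + 1 ≠ 0 := by positivity
  rw [chooseReal]
  field_simp
  ring

lemma sq_mul_chooseReal (d : ℕ) (y : ℝ) :
    y ^ 2 * chooseReal d y = (d + 1) * (d + 2) * chooseReal (d + 2) y
      + (d + 1) * (2 * d + 1) * chooseReal (d + 1) y + d ^ 2 * chooseReal d y := by
  have h1 := mul_chooseReal d y
  have h2 := mul_chooseReal (d + 1) y
  push_cast at h2
  rw [show d + 1 + 1 = d + 2 from rfl] at h2
  linear_combination (y + d) * h1 + (d + 1) * h2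

lemma succ_mul_chooseReal_succ (d : ℕ) (y : ℝ) :
    (d + 1) * chooseReal (d + 1) (y + 1) = (y + 1) * chooseReal d y := by
  induction d with
  | zero => simp [chooseReal]
  | succ d ih =>
    have h : ((d + 1 : ℕ) : ℝ) + 1 ≠ 0 := by positivity
    have h' : (d : ℝ) + 1 ≠ 0 := by positivity
    rw [chooseReal, mul_div_cancel₀ _ h, chooseReal.eq_2 y d]
    field_simp
    push_cast
    linear_combination (y - d) * ih

lemma chooseReal_succ_add_one_sub (d : ℕ) (y : ℝ) :
    chooseReal (d + 1) (y + 1) - chooseReal (d + 1) y = chooseReal d y := by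
  have h' : (d : ℝ) + 1 ≠ 0 := by positivity
  apply mul_left_cancel₀ h'
  linear_combination succ_mul_chooseReal_succ d y + mul_chooseReal d y

lemma sum_Ico_chooseReal (d : ℕ) {p q : ℤ} (h : p ≤ q) :
    ∑ y ∈ Ico p q, chooseReal d y = chooseReal (d + 1) q - chooseReal (d + 1) p := by
  induction q, h using Int.leInduction with
  | base => simp
  | succ q hq ih =>
    rw [← Finset.insert_Ico_right_eq_Ico_add_one hq, sum_insert (by simp), ih]
    push_cast
    linear_combination -chooseReal_succ_add_one_sub d q

/-! ### Binomial determinants times power sums -/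

/-- The determinant with entries `m i choose d j`. -/
noncomputable def chooseDet {n : ℕ} (d : Fin n → ℕ) (m : Fin n → ℤ) : ℝ :=
  Matrix.det (Matrix.of fun i j => chooseReal (d j) (m i))

lemma chooseDet_eq_zero {n : ℕ} {d : Fin n → ℕ} {i j : Fin n} (hij : i ≠ j) (h : d i = d j)
    (m : Fin n → ℤ) : chooseDet d m = 0 :=
  Matrix.det_zero_of_column_eq hij (by simp [h])

/-- In the Leibniz expansion, scaling column j by φ multiplies the term of σ by φ (σ j), and these
factors sum over j to the sum of φ. -/
lemma sum_mul_det {n : ℕ} (φ : Fin n → ℝ) (M : Matrix (Fin n) (Fin n) ℝ) :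
    (∑ i, φ i) * M.det = ∑ j, (M.updateCol j fun i => φ i * M i j).det := by
  simp_rw [Matrix.det_apply']
  rw [sum_comm, mul_sum]
  refine sum_congr rfl fun σ _ => ?_
  have h : ∀ j, ∏ i, (M.updateCol j fun i => φ i * M i j) (σ i) i
      = φ (σ j) * ∏ i, M (σ i) i := by
    intro j
    rw [← mul_prod_erase univ _ (mem_univ j), ← mul_prod_erase univ (fun i => M (σ i) i) (mem_univ j),
      ← mul_assoc]
    congr 1
    · simp
    · exact prod_congr rfl fun i hi => by simp [Matrix.updateCol_ne (ne_of_mem_erase hi)]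
  simp_rw [h, ← mul_sum]
  rw [← sum_mul, Equiv.sum_comp σ φ]
  ring

lemma chooseDet_updateCol {n : ℕ} (d : Fin n → ℕ) (m : Fin n → ℤ) (j : Fin n) (e : ℕ) :
    ((Matrix.of fun i j => chooseReal (d j) (m i)).updateCol j
      fun i => chooseReal e (m i)).det = chooseDet (Function.update d j e) m := by
  unfold chooseDet
  congr 1
  ext i k
  by_cases h : k = j
  · subst h; simp
  · simp [Matrix.updateCol_ne h, Function.update_of_ne h]

lemma sum_mul_chooseDet {n : ℕ} (d : Fin n → ℕ) (m : Fin n → ℤ) :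
    (∑ i, (m i : ℝ)) * chooseDet d m = ∑ j, (((d j : ℝ) + 1) *
      chooseDet (Function.update d j (d j + 1)) m + d j * chooseDet d m) := by
  rw [chooseDet, sum_mul_det]
  refine sum_congr rfl fun j _ => ?_
  have h : (fun i => (m i : ℝ) * (Matrix.of fun i j => chooseReal (d j) (m i)) i j)
      = (((d j : ℝ) + 1) • fun i => chooseReal (d j + 1) (m i))
        + ((d j : ℝ) • fun i => chooseReal (d j) (m i)) := by
    ext i
    simp [mul_chooseReal (d j) (m i)]
  rw [h, Matrix.det_updateCol_add, Matrix.det_updateCol_smul, Matrix.det_updateCol_smul,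
    chooseDet_updateCol, chooseDet_updateCol, Function.update_eq_self]
  rfl

lemma sum_sq_mul_chooseDet {n : ℕ} (d : Fin n → ℕ) (m : Fin n → ℤ) :
    (∑ i, (m i : ℝ) ^ 2) * chooseDet d m = ∑ j, (((d j : ℝ) + 1) * (d j + 2) *
      chooseDet (Function.update d j (d j + 2)) m + ((d j : ℝ) + 1) * (2 * d j + 1) *
      chooseDet (Function.update d j (d j + 1)) m + (d j : ℝ) ^ 2 * chooseDet d m) := by
  rw [chooseDet, sum_mul_det]
  refine sum_congr rfl fun j _ => ?_
  have h : (fun i => (m i : ℝ) ^ 2 * (Matrix.of fun i j => chooseReal (d j) (m i)) i j)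
      = ((((d j : ℝ) + 1) * (d j + 2)) • fun i => chooseReal (d j + 2) (m i))
        + ((((d j : ℝ) + 1) * (2 * d j + 1)) • fun i => chooseReal (d j + 1) (m i))
        + ((d j : ℝ) ^ 2 • fun i => chooseReal (d j) (m i)) := by
    ext i
    simp [sq_mul_chooseReal (d j) (m i)]
  rw [h, Matrix.det_updateCol_add, Matrix.det_updateCol_add, Matrix.det_updateCol_smul,
    Matrix.det_updateCol_smul, Matrix.det_updateCol_smul,
    chooseDet_updateCol, chooseDet_updateCol, chooseDet_updateCol, Function.update_eq_self]
  rfl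

/-! ### Summation over interlacing vectors -/

/-- The integer vectors `m` with `l 0 ≤ m 0 < l 1 ≤ m 1 < l 2 ≤ ⋯`. -/
noncomputable def interlacing {n : ℕ} (l : Fin (n + 1) → ℤ) : Finset (Fin n → ℤ) :=
  Fintype.piFinset fun i => Ico (l i.castSucc) (l i.succ)

lemma mem_interlacing {n : ℕ} {l : Fin (n + 1) → ℤ} {m : Fin n → ℤ} :
    m ∈ interlacing l ↔ ∀ i, l i.castSucc ≤ m i ∧ m i < l i.succ := by
  simp [interlacing]

lemma strictMono_of_mem_interlacing {n : ℕ} {l : Fin (n + 1) → ℤ} {m : Fin n → ℤ}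
    (h : m ∈ interlacing l) : StrictMono m := by
  rw [mem_interlacing] at h
  cases n with
  | zero => exact Subsingleton.strictMono m
  | succ n =>
    refine Fin.strictMono_iff_lt_succ.2 fun i => ?_
    have h1 := (h i.castSucc).2
    have h2 := (h i.succ).1
    rw [Fin.succ_castSucc] at h1
    exact h1.trans_le h2

/-- The entries of m range over independent intervals, so by multilinearity each row is summed
separately and telescopes to a difference of two consecutive rows. These differences also arise by
row operations from the larger matrix, whose first column consists of ones. -/
lemma sum_interlacing_chooseDet {n : ℕ} (d : Fin n → ℕ) {l : Fin (n + 1) → ℤ} (hl : Monotone l) :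
    ∑ m ∈ interlacing l, chooseDet d m
      = chooseDet (Fin.cons 0 fun j => d j + 1 : Fin (n + 1) → ℕ) l := by
  have h1 : ∑ m ∈ interlacing l, chooseDet d m = Matrix.det (Matrix.of fun i j : Fin n =>
      chooseReal (d j + 1) (l i.succ) - chooseReal (d j + 1) (l i.castSucc)) := by
    unfold chooseDet
    simp_rw [← sum_Ico_chooseReal _ (hl (Fin.castSucc_le_succ _))]
    rw [← Matrix.det_transpose, Matrix.det_apply']
    simp_rw [← Matrix.det_transpose (Matrix.of fun i j => chooseReal (d j) _), Matrix.det_apply']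
    rw [sum_comm]
    refine sum_congr rfl fun σ _ => ?_
    rw [← mul_sum]
    congr 1
    simp only [Matrix.transpose_apply, Matrix.of_apply]
    rw [prod_univ_sum]
    rfl
  rw [h1, chooseDet]
  symm
  set A : Matrix (Fin (n + 1)) (Fin (n + 1)) ℝ :=
    Matrix.of fun i j => chooseReal ((Fin.cons 0 fun j => d j + 1 : Fin (n + 1) → ℕ) j) (l i)
    with hA
  let B : Matrix (Fin (n + 1)) (Fin (n + 1)) ℝ :=
    Matrix.of fun i j => Fin.cases (A 0 j) (fun k => A k.succ j - A k.castSucc j) i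
  have hAB : A.det = B.det := by
    refine Matrix.det_eq_of_forall_row_eq_smul_add_pred (fun _ => 1) (fun j => ?_) fun i j => ?_
    · simp [B]
    · simp [B]
  rw [hAB, Matrix.det_succ_column_zero, Fin.sum_univ_succ]
  have h0 : ∀ i : Fin n, B i.succ 0 = 0 := fun i => by simp [B, hA, chooseReal]
  have h00 : B 0 0 = 1 := by simp [B, hA, chooseReal]
  simp only [h0, h00, mul_zero, zero_mul, sum_const_zero, add_zero, Fin.val_zero, pow_zero, one_mul]
  congr 1

/-! ### The exponent shapes (1), (2) and (1, 1) -/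

/-- The exponents `0, 1, …, n - 2, n`. -/
def expOne (n : ℕ) (j : Fin n) : ℕ := if (j : ℕ) + 1 = n then j + 1 else j

/-- The exponents `0, 1, …, n - 2, n + 1`. -/
def expTwo (n : ℕ) (j : Fin n) : ℕ := if (j : ℕ) + 1 = n then j + 2 else j

/-- The exponents `0, 1, …, n - 3, n - 1, n`. -/
def expOneOne (n : ℕ) (j : Fin n) : ℕ := if n ≤ (j : ℕ) + 2 then j + 1 else j

lemma cons_val (n : ℕ) :
    (Fin.cons 0 fun j : Fin n => (j : ℕ) + 1 : Fin (n + 1) → ℕ) = Fin.val := by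
  ext j
  cases j using Fin.cases <;> simp

lemma cons_expOne {n : ℕ} (hn : 1 ≤ n) :
    (Fin.cons 0 fun j : Fin n => expOne n j + 1 : Fin (n + 1) → ℕ) = expOne (n + 1) := by
  ext j
  cases j using Fin.cases with
  | zero => simp [expOne]; omega
  | succ j => simp only [Fin.cons_succ, expOne, Fin.val_succ]; split_ifs <;> omega

lemma cons_expTwo {n : ℕ} (hn : 1 ≤ n) :
    (Fin.cons 0 fun j : Fin n => expTwo n j + 1 : Fin (n + 1) → ℕ) = expTwo (n + 1) := by
  ext j
  cases j using Fin.cases with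
  | zero => simp [expTwo]; omega
  | succ j => simp only [Fin.cons_succ, expTwo, Fin.val_succ]; split_ifs <;> omega

lemma cons_expOneOne {n : ℕ} (hn : 2 ≤ n) :
    (Fin.cons 0 fun j : Fin n => expOneOne n j + 1 : Fin (n + 1) → ℕ) = expOneOne (n + 1) := by
  ext j
  cases j using Fin.cases with
  | zero => simp [expOneOne]; omega
  | succ j => simp only [Fin.cons_succ, expOneOne, Fin.val_succ]; split_ifs <;> omega

lemma update_val_last_one (n : ℕ) :
    Function.update (Fin.val : Fin (n + 1) → ℕ) (Fin.last n) (n + 1) = expOne (n + 1) := by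
  ext j
  cases j using Fin.lastCases with
  | last => simp [expOne]
  | cast j => simp [expOne, j.is_lt.ne]

lemma update_val_last_two (n : ℕ) :
    Function.update (Fin.val : Fin (n + 1) → ℕ) (Fin.last n) (n + 2) = expTwo (n + 1) := by
  ext j
  cases j using Fin.lastCases with
  | last => simp [expTwo]
  | cast j => simp [expTwo, j.is_lt.ne]

/-- Raising any exponent but the last makes it equal to its successor, and the determinant vanishes.
-/
lemma sum_update_val_add_one {n : ℕ} (w : ℕ → ℝ) (m : Fin (n + 1) → ℤ) :
    ∑ j : Fin (n + 1), w j * chooseDet (Function.update (Fin.val : Fin (n + 1) → ℕ) j (j + 1)) m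
      = w n * chooseDet (expOne (n + 1)) m := by
  rw [Fin.sum_univ_castSucc, sum_eq_zero, zero_add, Fin.val_last, update_val_last_one]
  intro i _
  rw [chooseDet_eq_zero (i := i.castSucc) (j := i.succ) (by simp [Fin.ext_iff]) ?_ m, mul_zero]
  rw [Function.update_self, Function.update_of_ne (by simp [Fin.ext_iff])]
  simp

lemma chooseDet_swap_eq_neg {n : ℕ} {i j : Fin n} (hij : i ≠ j) (d : Fin n → ℕ) (m : Fin n → ℤ) :
    chooseDet (d ∘ Equiv.swap i j) m = -chooseDet d m := by
  have := Matrix.det_permute' (Equiv.swap i j) (Matrix.of fun i j => chooseReal (d j) (m i))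
  rw [Equiv.Perm.sign_swap hij] at this
  unfold chooseDet
  simpa [Matrix.submatrix] using this

lemma sum_update_val_add_two {n : ℕ} (w : ℕ → ℝ) (m : Fin (n + 2) → ℤ) :
    ∑ j : Fin (n + 2), w j * chooseDet (Function.update (Fin.val : Fin (n + 2) → ℕ) j (j + 2)) m
      = w (n + 1) * chooseDet (expTwo (n + 2)) m - w n * chooseDet (expOneOne (n + 2)) m := by
  rw [Fin.sum_univ_castSucc, Fin.sum_univ_castSucc, sum_eq_zero, zero_add, Fin.val_last,
    update_val_last_two]
  -- Raising the second largest exponent n by two gives …, n + 2, n + 1: the shape (1, 1) with its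
  -- last two columns swapped, hence the minus sign.
  · have h : Function.update (Fin.val : Fin (n + 2) → ℕ) (Fin.last n).castSucc (n + 2)
        = expOneOne (n + 2) ∘ Equiv.swap (Fin.last n).castSucc (Fin.last (n + 1)) := by
      ext j
      by_cases h1 : j = (Fin.last n).castSucc
      · subst h1; simp [expOneOne]
      by_cases h2 : j = Fin.last (n + 1)
      · subst h2
        rw [Function.update_of_ne h1]
        simp [expOneOne]
      rw [Function.update_of_ne h1, Function.comp_apply, Equiv.swap_apply_of_ne_of_ne h1 h2]
      simp only [Fin.ext_iff, Fin.val_castSucc, Fin.val_last] at h1 h2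
      simp only [expOneOne]
      have := j.is_lt
      rw [if_neg (by omega)]
    simp only [Fin.val_castSucc, Fin.val_last]
    rw [h, chooseDet_swap_eq_neg (Fin.castSucc_lt_last _).ne]
    ring
  · intro i _
    rw [chooseDet_eq_zero (i := i.castSucc.castSucc) (j := i.succ.succ)
      (by simp [Fin.ext_iff]; omega) ?_ m, mul_zero]
    rw [Function.update_self, Function.update_of_ne (by simp [Fin.ext_iff]; omega)]
    simp

lemma sum_val (n : ℕ) : ∑ j : Fin n, ((j : ℕ) : ℝ) = (n : ℝ) * (n - 1) / 2 := by
  induction n with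
  | zero => simp
  | succ n ih => rw [Fin.sum_univ_castSucc]; simp [ih]; ring

lemma sum_val_sq (n : ℕ) :
    ∑ j : Fin n, ((j : ℕ) : ℝ) ^ 2 = (n : ℝ) * (n - 1) * (2 * n - 1) / 6 := by
  induction n with
  | zero => simp
  | succ n ih => rw [Fin.sum_univ_castSucc]; simp [ih]; ring

lemma sum_mul_chooseDet_val (n : ℕ) (m : Fin n → ℤ) :
    (∑ i, (m i : ℝ)) * chooseDet Fin.val m
      = (n : ℝ) * (n - 1) / 2 * chooseDet Fin.val m + n * chooseDet (expOne n) m := by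
  rw [sum_mul_chooseDet, sum_add_distrib, ← sum_mul, sum_val, add_comm]
  congr 1
  cases n with
  | zero => simp
  | succ n => rw [sum_update_val_add_one fun j => (j : ℝ) + 1]; push_cast; rfl

lemma sum_sq_mul_chooseDet_val (n : ℕ) (m : Fin n → ℤ) :
    (∑ i, (m i : ℝ) ^ 2) * chooseDet Fin.val m
      = (n : ℝ) * (n - 1) * (2 * n - 1) / 6 * chooseDet Fin.val m
        + n * (2 * n - 1) * chooseDet (expOne n) m
        + n * (n + 1) * chooseDet (expTwo n) m
        - n * (n - 1) * chooseDet (expOneOne n) m := by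
  rw [sum_sq_mul_chooseDet, sum_add_distrib, sum_add_distrib, ← sum_mul, sum_val_sq]
  match n with
  | 0 => simp
  | 1 =>
    rw [sum_update_val_add_one fun j => ((j : ℝ) + 1) * (2 * j + 1), Fin.sum_univ_one]
    have := update_val_last_two 0
    simp only [Fin.last_zero, zero_add] at this
    simp [this]
    ring
  | n + 2 =>
    rw [sum_update_val_add_one fun j => ((j : ℝ) + 1) * (2 * j + 1),
      sum_update_val_add_two fun j => ((j : ℝ) + 1) * (j + 2)]
    push_cast
    ring

/-- Only the exponents n and n - 2 can be raised by one without a collision; they lead to the shapes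
(2) and (1, 1). This is the third equation that separates these two determinants. -/
lemma sum_mul_chooseDet_expOne {n : ℕ} (hn : 2 ≤ n) (m : Fin n → ℤ) :
    (∑ i, (m i : ℝ)) * chooseDet (expOne n) m
      = (((n : ℝ) - 2) * (n - 1) / 2 + n) * chooseDet (expOne n) m
        + (n - 1) * chooseDet (expOneOne n) m
        + (n + 1) * chooseDet (expTwo n) m := by
  obtain ⟨n, rfl⟩ := Nat.exists_eq_add_of_le' hn
  have hcast : ∀ i : Fin (n + 1), expOne (n + 2) i.castSucc = i := fun i => by
    have := i.is_lt
    simp only [expOne, Fin.val_castSucc]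
    rw [if_neg (by omega)]
  have hlast : expOne (n + 2) (Fin.last (n + 1)) = n + 2 := by simp [expOne]
  rw [sum_mul_chooseDet, sum_add_distrib, ← sum_mul, Fin.sum_univ_castSucc, Fin.sum_univ_castSucc,
    Fin.sum_univ_castSucc]
  simp only [hcast, hlast, sum_val]
  rw [sum_eq_zero]
  · have h1 : Function.update (expOne (n + 2)) (Fin.last (n + 1)) (n + 2 + 1) = expTwo (n + 2) := by
      ext j
      cases j using Fin.lastCases with
      | last => simp [expTwo]
      | cast j => simp [expTwo, hcast, j.is_lt.ne]
    have h2 : Function.update (expOne (n + 2)) (Fin.last n).castSucc (n + 1)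
        = expOneOne (n + 2) := by
      ext j
      by_cases h1 : j = (Fin.last n).castSucc
      · subst h1; simp [expOneOne]
      rw [Function.update_of_ne h1]
      simp only [Fin.ext_iff, Fin.val_castSucc, Fin.val_last] at h1
      have := j.is_lt
      simp only [expOneOne, expOne]
      split_ifs <;> omega
    simp only [Fin.val_last, h1, h2]
    push_cast
    ring
  · intro i _
    rw [chooseDet_eq_zero (i := i.castSucc.castSucc) (j := i.succ.castSucc)
      (by simp [Fin.ext_iff]) ?_ m, mul_zero]
    rw [Function.update_self, Function.update_of_ne (by simp [Fin.ext_iff]), hcast]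
    simp

/-! ### Gelfand–Tsetlin patterns and their row sums -/

open Classical in
/-- The Gelfand–Tsetlin patterns with top row `l`, as sequences of the sets of entries of their
rows: the row with index `k` has `k` entries, and rows above the top row are empty. -/
noncomputable def patterns : (n : ℕ) → (Fin n → ℤ) → Finset (ℕ → Finset ℤ)
  | 0, _ => {fun _ => ∅}
  | n + 1, l => (interlacing l).biUnion fun m =>
      (patterns n m).image fun S => Function.update S (n + 1) (univ.image l)

lemma apply_of_mem_patterns {n : ℕ} {l : Fin n → ℤ} {S : ℕ → Finset ℤ} (hS : S ∈ patterns n l) :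
    S n = univ.image l ∧ ∀ k, n < k → S k = ∅ := by
  induction n generalizing S with
  | zero =>
    simp only [patterns, mem_singleton] at hS
    subst hS
    simp
  | succ n ih =>
    simp only [patterns, mem_biUnion, mem_image] at hS
    obtain ⟨m, -, R, hR, rfl⟩ := hS
    refine ⟨by simp, fun k hk => ?_⟩
    rw [Function.update_of_ne (by omega)]
    exact (ih hR).2 k (by omega)

lemma eq_of_image_eq_of_strictMono {n : ℕ} {l m : Fin n → ℤ} (hl : StrictMono l) (hm : StrictMono m)
    (h : univ.image l = univ.image m) : l = m := by
  apply (StrictMono.range_inj hl hm).1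
  simpa using congrArg (fun s : Finset ℤ => (s : Set ℤ)) h

lemma sum_patterns_succ {n : ℕ} (l : Fin (n + 1) → ℤ) (F : (ℕ → Finset ℤ) → ℝ) :
    ∑ S ∈ patterns (n + 1) l, F S = ∑ m ∈ interlacing l, ∑ S ∈ patterns n m,
      F (Function.update S (n + 1) (univ.image l)) := by
  classical
  rw [patterns, sum_biUnion]
  · refine sum_congr rfl fun m _ => ?_
    rw [sum_image]
    intro S hS R hR h
    ext1 k
    by_cases hk : k = n + 1
    -- The overwritten row was empty in both patterns, so the update is injective.
    · rw [(apply_of_mem_patterns hS).2 k (by omega), (apply_of_mem_patterns hR).2 k (by omega)]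
    · simpa [Function.update_of_ne hk] using congrFun h k
  · intro m hm m' hm' hne
    rw [Function.onFun, disjoint_left]
    intro S hS hS'
    simp only [mem_image] at hS hS'
    obtain ⟨R, hR, rfl⟩ := hS
    obtain ⟨R', hR', h⟩ := hS'
    apply hne
    apply eq_of_image_eq_of_strictMono (strictMono_of_mem_interlacing hm)
      (strictMono_of_mem_interlacing hm')
    rw [← (apply_of_mem_patterns hR).1, ← (apply_of_mem_patterns hR').1]
    have := congrFun h n
    rw [Function.update_of_ne (by omega), Function.update_of_ne (by omega)] at this
    exact this.symm

lemma card_patterns (n : ℕ) {l : Fin n → ℤ} (hl : StrictMono l) :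
    ((patterns n l).card : ℝ) = chooseDet Fin.val l := by
  induction n with
  | zero => simp [patterns, chooseDet]
  | succ n ih =>
    rw [← cons_val, ← sum_interlacing_chooseDet _ hl.monotone, card_eq_sum_ones]
    push_cast
    rw [sum_patterns_succ]
    refine sum_congr rfl fun m hm => ?_
    rw [← ih (strictMono_of_mem_interlacing hm)]
    simp

lemma interlacing_nonempty {n : ℕ} {l : Fin (n + 1) → ℤ} (hl : StrictMono l) :
    (interlacing l).Nonempty :=
  ⟨fun i => l i.castSucc, mem_interlacing.2 fun _ => ⟨le_rfl, hl Fin.castSucc_lt_succ⟩⟩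

lemma patterns_nonempty (n : ℕ) {l : Fin n → ℤ} (hl : StrictMono l) : (patterns n l).Nonempty := by
  induction n with
  | zero => simp [patterns]
  | succ n ih =>
    classical
    obtain ⟨m, hm⟩ := interlacing_nonempty hl
    obtain ⟨S, hS⟩ := ih (strictMono_of_mem_interlacing hm)
    exact ⟨_, mem_biUnion.2 ⟨m, hm, mem_image_of_mem _ hS⟩⟩

lemma sum_patterns_top {n : ℕ} {l : Fin n → ℤ} (hl : StrictMono l) (φ : ℤ → ℝ) :
    ∑ S ∈ patterns n l, ∑ y ∈ S n, φ y = (∑ i, φ (l i)) * chooseDet Fin.val l := by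
  rw [sum_congr rfl (g := fun _ => ∑ i, φ (l i)), sum_const, nsmul_eq_mul, card_patterns n hl,
    mul_comm]
  intro S hS
  rw [(apply_of_mem_patterns hS).1, sum_image fun i _ j _ h => hl.injective h]

lemma sum_patterns_succ_row {n k : ℕ} (hk : k ≤ n) (l : Fin (n + 1) → ℤ) (φ : ℤ → ℝ) :
    ∑ S ∈ patterns (n + 1) l, ∑ y ∈ S k, φ y
      = ∑ m ∈ interlacing l, ∑ S ∈ patterns n m, ∑ y ∈ S k, φ y := by
  rw [sum_patterns_succ]
  refine sum_congr rfl fun m _ => sum_congr rfl fun S _ => ?_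
  rw [Function.update_of_ne (by omega)]

/-- For n = k this is the power sum identity for the top row. Adding rows above only replaces each
determinant by the one of the same shape in the next size, so the coefficients keep depending on k
alone. -/
lemma sum_patterns_sum_row {n k : ℕ} (hk : 1 ≤ k) (hkn : k ≤ n) {l : Fin n → ℤ}
    (hl : StrictMono l) :
    ∑ S ∈ patterns n l, ∑ y ∈ S k, (y : ℝ)
      = (k : ℝ) * (k - 1) / 2 * chooseDet Fin.val l + k * chooseDet (expOne n) l := by
  induction n, hkn using Nat.le_induction with
  | base => rw [sum_patterns_top hl, sum_mul_chooseDet_val]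
  | succ n hkn ih =>
    rw [sum_patterns_succ_row hkn, sum_congr rfl fun m hm => ih (strictMono_of_mem_interlacing hm),
      sum_add_distrib, ← mul_sum, ← mul_sum, sum_interlacing_chooseDet _ hl.monotone,
      sum_interlacing_chooseDet _ hl.monotone, cons_val, cons_expOne (by omega)]

lemma sum_patterns_sum_sq_row {n k : ℕ} (hk : 1 ≤ k) (hkn : k ≤ n) {l : Fin n → ℤ}
    (hl : StrictMono l) :
    ∑ S ∈ patterns n l, ∑ y ∈ S k, (y : ℝ) ^ 2
      = (k : ℝ) * (k - 1) * (2 * k - 1) / 6 * chooseDet Fin.val l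
        + k * (2 * k - 1) * chooseDet (expOne n) l
        + k * (k + 1) * chooseDet (expTwo n) l
        - k * (k - 1) * chooseDet (expOneOne n) l := by
  induction n, hkn using Nat.le_induction with
  | base => rw [sum_patterns_top hl (fun y => (y : ℝ) ^ 2), sum_sq_mul_chooseDet_val]
  | succ n hkn ih =>
    rw [sum_patterns_succ_row hkn _ (fun y => (y : ℝ) ^ 2),
      sum_congr rfl fun m hm => ih (strictMono_of_mem_interlacing hm),
      sum_sub_distrib, sum_add_distrib, sum_add_distrib, ← mul_sum, ← mul_sum, ← mul_sum, ← mul_sum,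
      sum_interlacing_chooseDet _ hl.monotone, sum_interlacing_chooseDet _ hl.monotone,
      sum_interlacing_chooseDet _ hl.monotone, sum_interlacing_chooseDet _ hl.monotone,
      cons_val, cons_expOne (by omega), cons_expTwo (by omega)]
    -- The shape (1, 1) needs two exponents; for k = 1 its coefficient k (k - 1) is zero.
    rcases hk.eq_or_lt with rfl | hk
    · simp
    · rw [cons_expOneOne (by omega)]

/-! ### Interlacing through counting functions -/

/-- The number of elements of `A` that are at most `j`. -/
def countLE (A : Finset ℤ) (j : ℤ) : ℕ := (A.filter (· ≤ j)).card

lemma countLE_eq_add (A : Finset ℤ) (j : ℤ) :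
    countLE A j = countLE A (j - 1) + if j ∈ A then 1 else 0 := by
  unfold countLE
  have : A.filter (· ≤ j) = A.filter (· ≤ j - 1) ∪ A.filter (· = j) := by
    ext y; simp only [mem_filter, mem_union]; grind
  rw [this, card_union_of_disjoint, Finset.filter_eq']
  · split_ifs <;> simp
  · rw [disjoint_left]; intro y; simp only [mem_filter]; omega

lemma countLE_le_card (A : Finset ℤ) (j : ℤ) : countLE A j ≤ A.card := card_filter_le _ _

lemma countLE_eq_zero {A : Finset ℤ} {j : ℤ} : countLE A j = 0 ↔ ∀ y ∈ A, j < y := by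
  simp [countLE, filter_eq_empty_iff]

lemma countLE_eq_card {A : Finset ℤ} {j : ℤ} : countLE A j = A.card ↔ ∀ y ∈ A, y ≤ j := by
  simp [countLE, card_filter_eq_iff]

lemma lt_countLE_image {n : ℕ} {m : Fin n → ℤ} (hm : StrictMono m) (i : Fin n) (j : ℤ) :
    (i : ℕ) < countLE (univ.image m) j ↔ m i ≤ j := by
  have h : countLE (univ.image m) j = (univ.filter fun k => m k ≤ j).card := by
    rw [countLE, filter_image, card_image_of_injective _ hm.injective]
  rw [h]
  constructor
  · intro hlt
    by_contra! hj
    have : (univ.filter fun k => m k ≤ j) ⊆ Iio i := by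
      intro k hk
      simp only [mem_filter, mem_univ, true_and] at hk
      exact mem_Iio.2 (hm.lt_iff_lt.1 (hk.trans_lt hj))
    have := card_le_card this
    rw [Fin.card_Iio] at this
    omega
  · intro hle
    have : Iic i ⊆ univ.filter fun k => m k ≤ j := by
      intro k hk
      simp only [mem_filter, mem_univ, true_and]
      exact (hm.monotone (mem_Iic.1 hk)).trans hle
    have := card_le_card this
    rw [Fin.card_Iic] at this
    omega

/-- The interlacing relation for sets of integers, in terms of their counting functions. -/
def Interlaces (A B : Finset ℤ) : Prop :=
  ∀ j, countLE A j ≤ countLE B j ∧ countLE B j ≤ countLE A (j - 1) + 1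

lemma mem_interlacing_iff {n : ℕ} {l : Fin (n + 1) → ℤ} {m : Fin n → ℤ} (hl : StrictMono l)
    (hm : StrictMono m) :
    m ∈ interlacing l ↔ Interlaces (univ.image m) (univ.image l) := by
  have cm : (univ.image m).card = n := by simp [card_image_of_injective _ hm.injective]
  have cl : (univ.image l).card = n + 1 := by simp [card_image_of_injective _ hl.injective]
  rw [mem_interlacing]
  constructor
  · intro h j
    constructor
    · by_contra! hlt
      have hn := countLE_le_card (univ.image m) j
      have h1 := (lt_countLE_image hm ⟨countLE (univ.image l) j, by omega⟩ j).1 hlt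
      have h2 := (h ⟨countLE (univ.image l) j, by omega⟩).1
      have h3 := (lt_countLE_image hl _ j).2 (h2.trans h1)
      simp at h3
    · by_contra! hlt
      have hn := countLE_le_card (univ.image l) j
      let i : Fin n := ⟨countLE (univ.image m) (j - 1), by omega⟩
      have h1 := (lt_countLE_image hl i.succ j).1 (by simpa [i] using hlt)
      have h2 := (h i).2
      have h3 := (lt_countLE_image hm i (j - 1)).2 (by omega)
      simp [i] at h3
  · intro h i
    constructor
    · rw [← lt_countLE_image hl]
      have := (lt_countLE_image hm i (m i)).2 le_rfl
      have := (h (m i)).1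
      rw [Fin.val_castSucc]
      omega
    · have h1 := (lt_countLE_image hl i.succ (l i.succ)).2 le_rfl
      have h2 := (h (l i.succ)).2
      rw [Fin.val_succ] at h1
      have := (lt_countLE_image hm i (l i.succ - 1)).1 (by omega)
      omega

lemma exists_strictMono_image_eq {n : ℕ} {A : Finset ℤ} (h : A.card = n) :
    ∃ m : Fin n → ℤ, StrictMono m ∧ univ.image m = A :=
  ⟨A.orderEmbOfFin h, (A.orderEmbOfFin h).strictMono, by
    rw [← coe_inj]; simp⟩

lemma mem_patterns_iff {n : ℕ} {l : Fin n → ℤ} (hl : StrictMono l) {S : ℕ → Finset ℤ} :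
    S ∈ patterns n l ↔ S n = univ.image l ∧ (∀ k, n < k → S k = ∅) ∧ (∀ k ≤ n, (S k).card = k) ∧
      ∀ k < n, Interlaces (S k) (S (k + 1)) := by
  induction n generalizing S with
  | zero =>
    simp only [patterns, mem_singleton]
    constructor
    · rintro rfl; simp
    · rintro ⟨h0, h1, -, -⟩
      ext1 k
      rcases Nat.eq_zero_or_pos k with rfl | hk
      · simpa using h0
      · exact h1 k hk
  | succ n ih =>
    have cl : (univ.image l).card = n + 1 := by simp [card_image_of_injective _ hl.injective]
    constructor
    · intro hS
      refine ⟨(apply_of_mem_patterns hS).1, (apply_of_mem_patterns hS).2, ?_⟩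
      simp only [patterns, mem_biUnion, mem_image] at hS
      obtain ⟨m, hm, R, hR, rfl⟩ := hS
      have hm' := strictMono_of_mem_interlacing hm
      obtain ⟨h1, h2, h3, h4⟩ := (ih hm').1 hR
      constructor
      · intro k hk
        rcases hk.eq_or_lt with rfl | hk
        · simpa using cl
        · rw [Function.update_of_ne (by omega)]
          exact h3 k (by omega)
      · intro k hk
        rw [Function.update_of_ne (by omega)]
        rcases (Nat.lt_succ_iff.1 hk).eq_or_lt with rfl | hk
        · rw [Function.update_self, h1]
          exact (mem_interlacing_iff hl hm').1 hm
        · rw [Function.update_of_ne (by omega)]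
          exact h4 k hk
    · rintro ⟨h1, h2, h3, h4⟩
      obtain ⟨m, hm, hmS⟩ := exists_strictMono_image_eq (h3 n (by omega))
      simp only [patterns, mem_biUnion, mem_image]
      refine ⟨m, ?_, Function.update S (n + 1) ∅, ?_, ?_⟩
      · rw [mem_interlacing_iff hl hm, hmS, ← h1]
        exact h4 n (by omega)
      · rw [ih hm]
        refine ⟨by rw [Function.update_of_ne (by omega), hmS], fun k hk => ?_, fun k hk => ?_,
          fun k hk => ?_⟩
        · by_cases hk' : k = n + 1
          · subst hk'; simp
          · rw [Function.update_of_ne hk']; exact h2 k (by omega)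
        · rw [Function.update_of_ne (by omega)]; exact h3 k (by omega)
        · rw [Function.update_of_ne (by omega), Function.update_of_ne (by omega)]
          exact h4 k (by omega)
      · rw [Function.update_idem, ← h1, Function.update_eq_self]

/-! ### Triangles, lozenges and tilings in coordinates -/

lemma mem_hexagon_true {a b c : ℕ} {i j : ℤ} :
    ((i, j, true) : Tri) ∈ hexagon a b c ↔ 0 ≤ i ∧ i + 1 ≤ a + b ∧ 0 ≤ j ∧ j + 1 ≤ a + c ∧
      -(b : ℤ) ≤ j - i ∧ j + 1 - i ≤ c := by
  rw [hexagon, mem_filter]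
  simp only [mem_product, mem_Icc, mem_univ, and_true, Tri.vertices,
    mem_insert, mem_singleton, forall_eq_or_imp, forall_eq, InHexagon]
  omega

lemma mem_hexagon_false {a b c : ℕ} {i j : ℤ} :
    ((i, j, false) : Tri) ∈ hexagon a b c ↔ 0 ≤ i ∧ i + 1 ≤ a + b ∧ 0 ≤ j ∧ j + 1 ≤ a + c ∧
      1 - (b : ℤ) ≤ j - i ∧ j - i ≤ c := by
  rw [hexagon, mem_filter]
  simp only [mem_product, mem_Icc, mem_univ, and_true, Tri.vertices,
    mem_insert, mem_singleton, forall_eq_or_imp, forall_eq, InHexagon]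
  omega

lemma card_vertices (t : Tri) : t.vertices.card = 3 := by
  obtain ⟨i, j, _ | _⟩ := t <;> simp only [Tri.vertices] <;> rw [card_eq_three]
  · exact ⟨_, _, _, by simp, by simp, by simp, rfl⟩
  · exact ⟨_, _, _, by simp, by simp, by simp, rfl⟩

lemma card_inter_vertices_true_true (i j i' j' : ℤ) :
    (Tri.vertices (i, j, true) ∩ Tri.vertices (i', j', true)).card ≠ 2 := by
  intro h
  have hne : ¬ (i = i' ∧ j = j') := by
    rintro ⟨rfl, rfl⟩
    rw [inter_self, card_vertices] at h
    omega
  obtain ⟨⟨p1, p2⟩, ⟨q1, q2⟩, hpq, h⟩ := card_eq_two.1 h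
  have hp : (p1, p2) ∈ Tri.vertices (i, j, true) ∩ Tri.vertices (i', j', true) := by simp [h]
  have hq : (q1, q2) ∈ Tri.vertices (i, j, true) ∩ Tri.vertices (i', j', true) := by simp [h]
  simp only [Tri.vertices, mem_inter, mem_insert, mem_singleton, Prod.mk.injEq, ne_eq] at hp hq hpq
  omega

lemma card_inter_vertices_false_false (i j i' j' : ℤ) :
    (Tri.vertices (i, j, false) ∩ Tri.vertices (i', j', false)).card ≠ 2 := by
  intro h
  have hne : ¬ (i = i' ∧ j = j') := by
    rintro ⟨rfl, rfl⟩
    rw [inter_self, card_vertices] at h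
    omega
  obtain ⟨⟨p1, p2⟩, ⟨q1, q2⟩, hpq, h⟩ := card_eq_two.1 h
  have hp : (p1, p2) ∈ Tri.vertices (i, j, false) ∩ Tri.vertices (i', j', false) := by simp [h]
  have hq : (q1, q2) ∈ Tri.vertices (i, j, false) ∩ Tri.vertices (i', j', false) := by simp [h]
  simp only [Tri.vertices, mem_inter, mem_insert, mem_singleton, Prod.mk.injEq, ne_eq] at hp hq hpq
  omega

lemma card_inter_vertices_false_true (i j i' j' : ℤ) :
    (Tri.vertices (i, j, false) ∩ Tri.vertices (i', j', true)).card = 2 ↔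
      i + 1 = i' ∧ j = j' ∨ i = i' ∧ j = j' ∨ i = i' ∧ j = j' + 1 := by
  constructor
  · intro h
    obtain ⟨⟨p1, p2⟩, ⟨q1, q2⟩, hpq, h⟩ := card_eq_two.1 h
    have hp : (p1, p2) ∈ Tri.vertices (i, j, false) ∩ Tri.vertices (i', j', true) := by simp [h]
    have hq : (q1, q2) ∈ Tri.vertices (i, j, false) ∩ Tri.vertices (i', j', true) := by simp [h]
    simp only [Tri.vertices, mem_inter, mem_insert, mem_singleton, Prod.mk.injEq, ne_eq] at hp hq hpq
    omega
  · rintro (⟨rfl, rfl⟩ | ⟨rfl, rfl⟩ | ⟨rfl, rfl⟩) <;> rw [card_eq_two]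
    · refine ⟨(i + 1, j), (i + 1, j + 1), by simp, ?_⟩
      ext ⟨u, v⟩
      simp only [Tri.vertices, mem_inter, mem_insert, mem_singleton, Prod.mk.injEq]
      omega
    · refine ⟨(i, j), (i + 1, j + 1), by simp, ?_⟩
      ext ⟨u, v⟩
      simp only [Tri.vertices, mem_inter, mem_insert, mem_singleton, Prod.mk.injEq]
      omega
    · refine ⟨(i, j' + 1), (i + 1, j' + 1), by simp, ?_⟩
      ext ⟨u, v⟩
      simp only [Tri.vertices, mem_inter, mem_insert, mem_singleton, Prod.mk.injEq]
      omega

/-- The union of a triangle `(i, j, false)` and a triangle `(i', j', true)`. -/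
def triPair (i j i' j' : ℤ) : Finset Tri := {(i, j, false), (i', j', true)}

lemma triPair_inj {i j i' j' k l k' l' : ℤ} :
    triPair i j i' j' = triPair k l k' l' ↔ i = k ∧ j = l ∧ i' = k' ∧ j' = l' := by
  constructor
  · intro h
    have h1 : ((i, j, false) : Tri) ∈ triPair k l k' l' := by rw [← h]; simp [triPair]
    have h2 : ((i', j', true) : Tri) ∈ triPair k l k' l' := by rw [← h]; simp [triPair]
    simp only [triPair, mem_insert, mem_singleton, Prod.mk.injEq] at h1 h2
    simp at h1 h2
    tauto
  · rintro ⟨rfl, rfl, rfl, rfl⟩; rfl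

lemma mem_lozenges {a b c : ℕ} {s : Finset Tri} :
    s ∈ lozenges a b c ↔ ∃ i j i' j', ((i, j, false) : Tri) ∈ hexagon a b c ∧
      ((i', j', true) : Tri) ∈ hexagon a b c ∧
      (i + 1 = i' ∧ j = j' ∨ i = i' ∧ j = j' ∨ i = i' ∧ j = j' + 1) ∧ s = triPair i j i' j' := by
  simp only [lozenges, mem_image, mem_filter, mem_product, Prod.exists]
  constructor
  · rintro ⟨i, j, x, i', j', x', ⟨⟨h1, h2⟩, h3⟩, rfl⟩
    cases x <;> cases x'
    · exact absurd h3 (card_inter_vertices_false_false _ _ _ _)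
    · exact ⟨i, j, i', j', h1, h2, (card_inter_vertices_false_true _ _ _ _).1 h3, rfl⟩
    · rw [inter_comm] at h3
      exact ⟨i', j', i, j, h2, h1, (card_inter_vertices_false_true _ _ _ _).1 h3,
        Finset.pair_comm _ _⟩
    · exact absurd h3 (card_inter_vertices_true_true _ _ _ _)
  · rintro ⟨i, j, i', j', h1, h2, h3, rfl⟩
    exact ⟨i, j, false, i', j', true, ⟨⟨h1, h2⟩, (card_inter_vertices_false_true _ _ _ _).2 h3⟩, rfl⟩

lemma triPair_mem_lozenges {a b c : ℕ} {i j i' j' : ℤ} :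
    triPair i j i' j' ∈ lozenges a b c ↔ ((i, j, false) : Tri) ∈ hexagon a b c ∧
      ((i', j', true) : Tri) ∈ hexagon a b c ∧
      (i + 1 = i' ∧ j = j' ∨ i = i' ∧ j = j' ∨ i = i' ∧ j = j' + 1) := by
  rw [mem_lozenges]
  constructor
  · rintro ⟨k, l, k', l', h1, h2, h3, h⟩
    obtain ⟨rfl, rfl, rfl, rfl⟩ := triPair_inj.1 h
    exact ⟨h1, h2, h3⟩
  · rintro ⟨h1, h2, h3⟩
    exact ⟨_, _, _, _, h1, h2, h3, rfl⟩

lemma horizontalLozenge_eq (x y : ℤ) : horizontalLozenge x y = triPair (x - 1) y x y := rfl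

lemma card_filter_mem_true {a b c : ℕ} {T : Finset (Finset Tri)} (hT : T ⊆ lozenges a b c)
    (i j : ℤ) :
    (T.filter fun s => ((i, j, true) : Tri) ∈ s).card =
      (if triPair (i - 1) j i j ∈ T then 1 else 0) + (if triPair i j i j ∈ T then 1 else 0)
        + if triPair i (j + 1) i j ∈ T then 1 else 0 := by
  have h : T.filter (fun s => ((i, j, true) : Tri) ∈ s)
      = ({triPair (i - 1) j i j, triPair i j i j, triPair i (j + 1) i j} : Finset _).filter
        (· ∈ T) := by
    ext s
    simp only [mem_filter, mem_insert, mem_singleton]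
    constructor
    · rintro ⟨hs, hm⟩
      refine ⟨?_, hs⟩
      obtain ⟨k, l, k', l', -, -, h3, rfl⟩ := mem_lozenges.1 (hT hs)
      simp [triPair] at hm
      simp only [triPair_inj]
      omega
    · rintro ⟨rfl | rfl | rfl, hs⟩ <;> exact ⟨hs, by simp [triPair]⟩
  rw [h, card_filter, sum_insert, sum_insert, sum_singleton, add_assoc] <;>
    simp only [mem_insert, mem_singleton, triPair_inj] <;> omega

lemma card_filter_mem_false {a b c : ℕ} {T : Finset (Finset Tri)} (hT : T ⊆ lozenges a b c)
    (i j : ℤ) :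
    (T.filter fun s => ((i, j, false) : Tri) ∈ s).card =
      (if triPair i j (i + 1) j ∈ T then 1 else 0) + (if triPair i j i j ∈ T then 1 else 0)
        + if triPair i j i (j - 1) ∈ T then 1 else 0 := by
  have h : T.filter (fun s => ((i, j, false) : Tri) ∈ s)
      = ({triPair i j (i + 1) j, triPair i j i j, triPair i j i (j - 1)} : Finset _).filter
        (· ∈ T) := by
    ext s
    simp only [mem_filter, mem_insert, mem_singleton]
    constructor
    · rintro ⟨hs, hm⟩
      refine ⟨?_, hs⟩
      obtain ⟨k, l, k', l', -, -, h3, rfl⟩ := mem_lozenges.1 (hT hs)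
      simp [triPair] at hm
      simp only [triPair_inj]
      omega
    · rintro ⟨rfl | rfl | rfl, hs⟩ <;> exact ⟨hs, by simp [triPair]⟩
  rw [h, card_filter, sum_insert, sum_insert, sum_singleton, add_assoc] <;>
    simp only [mem_insert, mem_singleton, triPair_inj] <;> omega

lemma mem_tilings {a b c : ℕ} {T : Finset (Finset Tri)} :
    T ∈ tilings a b c ↔ T ⊆ lozenges a b c ∧
      (∀ i j, ((i, j, true) : Tri) ∈ hexagon a b c →
        (if triPair (i - 1) j i j ∈ T then 1 else 0) + (if triPair i j i j ∈ T then 1 else 0)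
          + (if triPair i (j + 1) i j ∈ T then 1 else 0) = 1) ∧
      ∀ i j, ((i, j, false) : Tri) ∈ hexagon a b c →
        (if triPair i j (i + 1) j ∈ T then 1 else 0) + (if triPair i j i j ∈ T then 1 else 0)
          + (if triPair i j i (j - 1) ∈ T then 1 else 0) = 1 := by
  rw [tilings, mem_filter, mem_powerset]
  refine and_congr_right fun hT => ⟨fun h => ⟨fun i j hij => ?_, fun i j hij => ?_⟩, ?_⟩
  · rw [← card_filter_mem_true hT, h _ hij]
  · rw [← card_filter_mem_false hT, h _ hij]
  · rintro ⟨h1, h2⟩ ⟨i, j, _ | _⟩ hij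
    · rw [card_filter_mem_false hT, h2 _ _ hij]
    · rw [card_filter_mem_true hT, h1 _ _ hij]

/-! ### From tilings to patterns -/

/-- The top row of the Gelfand–Tsetlin patterns that correspond to tilings of the hexagon. -/
def topRow (a b c : ℕ) (i : Fin (a + b)) : ℤ := if (i : ℕ) < a then (i : ℤ) else c + i

lemma topRow_strictMono (a b c : ℕ) : StrictMono (topRow a b c) := by
  intro i j h
  have : (i : ℕ) < j := h
  simp only [topRow]
  split_ifs <;> omega

lemma mem_image_topRow {a b c : ℕ} {y : ℤ} :
    y ∈ univ.image (topRow a b c) ↔ 0 ≤ y ∧ y < a ∨ a + c ≤ y ∧ y < a + b + c := by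
  simp only [mem_image, mem_univ, true_and]
  constructor
  · rintro ⟨i, rfl⟩
    have := i.is_lt
    simp only [topRow]
    split_ifs <;> omega
  · rintro (h | h)
    · refine ⟨⟨y.toNat, by omega⟩, ?_⟩
      simp only [topRow]
      rw [if_pos (by omega)]
      omega
    · refine ⟨⟨(y - c).toNat, by omega⟩, ?_⟩
      simp only [topRow]
      rw [if_neg (by omega)]
      omega

/-- The positions of the horizontal lozenges of a tiling on the vertical lines `x = 0, …, a + b`,
together with those of the horizontal lozenges that are forced when the hexagon is extended to a
trapezoid. -/
noncomputable def rows (a b c : ℕ) (T : Finset (Finset Tri)) (x : ℕ) : Finset ℤ :=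
  if x ≤ a + b then (Ico (0 : ℤ) (c + x)).filter
    fun y => horizontalLozenge x y ∈ T ∨ y < (x : ℤ) - b ∨ (a : ℤ) + c ≤ y else ∅

lemma mem_rows {a b c : ℕ} {T : Finset (Finset Tri)} {x : ℕ} {y : ℤ} :
    y ∈ rows a b c T x ↔ x ≤ a + b ∧ (0 ≤ y ∧ y < c + x) ∧
      (triPair (x - 1) y x y ∈ T ∨ y < (x : ℤ) - b ∨ (a : ℤ) + c ≤ y) := by
  unfold rows
  split_ifs with h
  · rw [mem_filter, mem_Ico, horizontalLozenge_eq]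
    simp [h]
  · simp [h]

variable {a b c : ℕ} {T : Finset (Finset Tri)}

lemma triPair_mem_tiling (hT : T ∈ tilings a b c) {i j i' j' : ℤ} (h : triPair i j i' j' ∈ T) :
    (0 ≤ i ∧ i + 1 ≤ a + b ∧ 0 ≤ j ∧ j + 1 ≤ a + c ∧ 1 - (b : ℤ) ≤ j - i ∧ j - i ≤ c) ∧
    (0 ≤ i' ∧ i' + 1 ≤ a + b ∧ 0 ≤ j' ∧ j' + 1 ≤ a + c ∧ -(b : ℤ) ≤ j' - i' ∧ j' + 1 - i' ≤ c) := by
  have := triPair_mem_lozenges.1 ((mem_tilings.1 hT).1 h)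
  rw [mem_hexagon_false, mem_hexagon_true] at this
  exact ⟨this.1, this.2.1⟩

/-- The covering condition, extended to the whole vertical strip: non-horizontal lozenges of one
kind are imagined below 0 and of the other kind from c + x upwards, while the forced positions in
`rows` cover the triangles between these ranges and the hexagon. -/
lemma rows_true (hT : T ∈ tilings a b c) {x : ℕ} (hx : x < a + b) (j : ℤ) :
    (if j ∈ rows a b c T x then 1 else 0) + (if triPair x j x j ∈ T ∨ j < 0 then 1 else 0)
      + (if triPair x (j + 1) x j ∈ T ∨ c + x ≤ j then 1 else 0) = 1 := by
  have h1 := (mem_tilings.1 hT).2.1 x j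
  have hH := triPair_mem_tiling hT (i := x - 1) (j := j) (i' := x) (j' := j)
  have hD := triPair_mem_tiling hT (i := x) (j := j) (i' := x) (j' := j)
  have hU := triPair_mem_tiling hT (i := x) (j := j + 1) (i' := x) (j' := j)
  rw [mem_hexagon_true] at h1
  simp only [mem_rows]
  grind

lemma rows_false (hT : T ∈ tilings a b c) {x : ℕ} (hx : x < a + b) (j : ℤ) :
    (if j ∈ rows a b c T (x + 1) then 1 else 0) + (if triPair x j x j ∈ T ∨ j < 0 then 1 else 0)
      + (if triPair x j x (j - 1) ∈ T ∨ c + x ≤ j - 1 then 1 else 0) = 1 := by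
  have h1 := (mem_tilings.1 hT).2.2 x j
  have hH := triPair_mem_tiling hT (i := x) (j := j) (i' := x + 1) (j' := j)
  have hD := triPair_mem_tiling hT (i := x) (j := j) (i' := x) (j' := j)
  have hU := triPair_mem_tiling hT (i := x) (j := j) (i' := x) (j' := j - 1)
  rw [mem_hexagon_false] at h1
  simp only [mem_rows]
  push_cast
  rw [add_sub_cancel_right]
  grind

/-- Subtracting `rows_true` from `rows_false` cancels the lozenge `triPair x j x j` and leaves a
difference of consecutive values of the last indicator, so the counts telescope in j. -/
lemma countLE_rows_succ (hT : T ∈ tilings a b c) {x : ℕ} (hx : x < a + b) (j : ℤ) :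
    countLE (rows a b c T (x + 1)) j = countLE (rows a b c T x) j
      + if triPair x (j + 1) x j ∈ T ∨ c + x ≤ j then 1 else 0 := by
  have hneg : ∀ j < 0, countLE (rows a b c T (x + 1)) j = countLE (rows a b c T x) j
      + if triPair x (j + 1) x j ∈ T ∨ c + x ≤ j then 1 else 0 := by
    intro j hj
    have h0 : ∀ k, countLE (rows a b c T k) j = 0 := fun k =>
      countLE_eq_zero.2 fun y hy => by
        have := (mem_rows.1 hy).2.1.1
        omega
    have := triPair_mem_tiling hT (i := x) (j := j + 1) (i' := x) (j' := j)
    rw [h0, h0, if_neg]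
    grind
  rcases lt_or_ge j 0 with hj | hj
  · exact hneg j hj
  have hj' : -1 ≤ j := by omega
  clear hj
  induction j, hj' using Int.leInduction with
  | base => exact hneg _ (by omega)
  | succ j hj ih =>
    rw [countLE_eq_add _ (j + 1), countLE_eq_add (rows a b c T x) (j + 1)]
    have h1 := rows_true hT hx (j + 1)
    have h2 := rows_false hT hx (j + 1)
    rw [add_sub_cancel_right] at h2 ⊢
    omega

lemma rows_interlaces (hT : T ∈ tilings a b c) {x : ℕ} (hx : x < a + b) :
    Interlaces (rows a b c T x) (rows a b c T (x + 1)) := by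
  intro j
  have h1 := rows_true hT hx j
  have h2 := countLE_eq_add (rows a b c T x) j
  have h3 := countLE_rows_succ hT hx j
  omega

lemma card_rows (hT : T ∈ tilings a b c) {x : ℕ} (hx : x ≤ a + b) :
    (rows a b c T x).card = x := by
  induction x with
  | zero =>
    rw [card_eq_zero, eq_empty_iff_forall_notMem]
    intro y hy
    have := triPair_mem_tiling hT (i := (0 : ℕ) - 1) (j := y) (i' := (0 : ℕ)) (j' := y)
    rw [mem_rows] at hy
    grind
  | succ x ih =>
    have h := countLE_rows_succ hT hx (c + x)
    rw [if_pos (Or.inr le_rfl), countLE_eq_card.2, countLE_eq_card.2, ih (by omega)] at h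
    · exact h
    · intro y hy
      have := (mem_rows.1 hy).2.1.2
      omega
    · intro y hy
      have := (mem_rows.1 hy).2.1.2
      omega

lemma rows_mem_patterns (hT : T ∈ tilings a b c) :
    rows a b c T ∈ patterns (a + b) (topRow a b c) := by
  rw [mem_patterns_iff (topRow_strictMono a b c)]
  refine ⟨?_, fun k hk => ?_, fun k hk => card_rows hT hk, fun k hk => rows_interlaces hT hk⟩
  · ext y
    have := triPair_mem_tiling hT (i := (a + b : ℕ) - 1) (j := y) (i' := (a + b : ℕ)) (j' := y)
    rw [mem_image_topRow, mem_rows]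
    grind
  · rw [rows, if_neg (by omega)]

/-- The rows give the horizontal lozenges directly, the upper ones as the jumps in
`countLE_rows_succ`, and the lower ones by exclusion in `rows_true`. -/
lemma subset_of_rows_eq {T' : Finset (Finset Tri)} (hT : T ∈ tilings a b c)
    (hT' : T' ∈ tilings a b c) (h : rows a b c T = rows a b c T') : T ⊆ T' := by
  intro s hs
  obtain ⟨i, j, i', j', h1, h2, h3, rfl⟩ := mem_lozenges.1 ((mem_tilings.1 hT).1 hs)
  rw [mem_hexagon_false] at h1
  rw [mem_hexagon_true] at h2
  lift i' to ℕ using h2.1 with x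
  rcases h3 with ⟨h3, rfl⟩ | ⟨rfl, rfl⟩ | ⟨rfl, rfl⟩
  · obtain rfl : i = (x : ℤ) - 1 := by omega
    have e : j ∈ rows a b c T x := mem_rows.2 ⟨by omega, by omega, Or.inl hs⟩
    rw [h, mem_rows] at e
    grind
  · have t1 := rows_true hT (x := x) (by omega) j
    have t2 := rows_true hT' (x := x) (by omega) j
    have u1 := countLE_rows_succ hT (x := x) (by omega) j
    have u2 := countLE_rows_succ hT' (x := x) (by omega) j
    rw [h] at t1 u1
    grind
  · have u1 := countLE_rows_succ hT (x := x) (by omega) j'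
    have u2 := countLE_rows_succ hT' (x := x) (by omega) j'
    rw [h] at u1
    grind

/-! ### From patterns back to tilings -/

lemma countLE_topRow (a b c : ℕ) (j : ℤ) :
    (countLE (univ.image (topRow a b c)) j : ℤ)
      = max 0 (min (j + 1) a) + max 0 (min (j + 1 - (a + c)) b) := by
  have hneg : ∀ j < 0, (countLE (univ.image (topRow a b c)) j : ℤ)
      = max 0 (min (j + 1) a) + max 0 (min (j + 1 - (a + c)) b) := by
    intro j hj
    rw [countLE_eq_zero.2]
    · omega
    · intro y hy
      rw [mem_image_topRow] at hy
      omega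
  rcases lt_or_ge j 0 with hj | hj
  · exact hneg j hj
  have hj' : -1 ≤ j := by omega
  clear hj
  induction j, hj' using Int.leInduction with
  | base => exact hneg _ (by omega)
  | succ j hj ih =>
    rw [countLE_eq_add, add_sub_cancel_right]
    push_cast
    rw [ih]
    simp only [mem_image_topRow]
    split_ifs <;> omega

variable {S : ℕ → Finset ℤ}

lemma countLE_le_of_interlaces {N : ℕ} (h : ∀ k < N, Interlaces (S k) (S (k + 1))) {x : ℕ}
    (hx : x ≤ N) (j : ℤ) : countLE (S x) j ≤ countLE (S N) j ∧
      countLE (S N) (j + (N - x)) ≤ countLE (S x) j + (N - x) := by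
  induction N, hx using Nat.le_induction with
  | base => simp
  | succ N hx ih =>
    obtain ⟨h1, h2⟩ := ih fun k hk => h k (by omega)
    refine ⟨h1.trans (h N (by omega) j).1, ?_⟩
    have h3 := (h N (by omega) (j + ((N + 1 : ℕ) - x))).2
    rw [show j + ((N + 1 : ℕ) - x) - 1 = j + (N - x) by push_cast; ring] at h3
    omega

lemma bounds_of_mem_patterns (hS : S ∈ patterns (a + b) (topRow a b c)) {x : ℕ} (hx : x ≤ a + b)
    (j : ℤ) :
    (countLE (S x) j : ℤ) ≤ max 0 (min (j + 1) a) + max 0 (min (j + 1 - (a + c)) b) ∧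
      max 0 (min (j + (a + b - x) + 1) a) + max 0 (min (j + (a + b - x) + 1 - (a + c)) b)
        ≤ (countLE (S x) j : ℤ) + (a + b - x) := by
  obtain ⟨h1, -, -, h4⟩ := (mem_patterns_iff (topRow_strictMono a b c)).1 hS
  obtain ⟨h5, h6⟩ := countLE_le_of_interlaces h4 hx j
  have e1 := countLE_topRow a b c j
  have e2 := countLE_topRow a b c (j + ((a + b : ℕ) - x))
  rw [← h1] at e1 e2
  push_cast at *
  omega

lemma mem_Ico_of_mem_patterns (hS : S ∈ patterns (a + b) (topRow a b c)) {x : ℕ} (hx : x ≤ a + b)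
    {y : ℤ} (hy : y ∈ S x) : 0 ≤ y ∧ y < c + x := by
  obtain ⟨-, -, h3, -⟩ := (mem_patterns_iff (topRow_strictMono a b c)).1 hS
  constructor
  · have h1 := (bounds_of_mem_patterns hS hx (-1)).1
    have := countLE_eq_zero.1 (show countLE (S x) (-1) = 0 by omega) y hy
    omega
  · have h1 := (bounds_of_mem_patterns hS hx (c + x - 1)).2
    have h2 := countLE_le_card (S x) (c + x - 1)
    have := h3 x hx
    have := countLE_eq_card.1 (show countLE (S x) (c + x - 1) = (S x).card by omega) y hy
    omega

/-- At a forced position y, the lower bound for the count up to y exceeds the upper bound for the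
count up to y - 1. -/
lemma mem_of_mem_patterns (hS : S ∈ patterns (a + b) (topRow a b c)) {x : ℕ} (hx : x ≤ a + b)
    {y : ℤ} (hy : 0 ≤ y ∧ y < c + x) (h : y < (x : ℤ) - b ∨ (a : ℤ) + c ≤ y) : y ∈ S x := by
  have h1 := bounds_of_mem_patterns hS hx (y - 1)
  have h2 := bounds_of_mem_patterns hS hx y
  have h3 := countLE_eq_add (S x) y
  by_contra hn
  rw [if_neg hn] at h3
  omega

open Classical in
/-- The tiling of the hexagon whose horizontal lozenges have the positions recorded by `S`. -/
noncomputable def tilingOf (a b c : ℕ) (S : ℕ → Finset ℤ) : Finset (Finset Tri) :=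
  (lozenges a b c).filter fun s => ∃ x : ℕ, ∃ j : ℤ,
    s = triPair (x - 1) j x j ∧ j ∈ S x ∨
    s = triPair x j x j ∧ countLE (S (x + 1)) j = countLE (S x) (j - 1) ∨
    s = triPair x (j + 1) x j ∧ countLE (S (x + 1)) j = countLE (S x) j + 1

lemma horizontal_mem_tilingOf {x : ℕ} {j : ℤ} : triPair (x - 1) j x j ∈ tilingOf a b c S ↔
    (1 ≤ x ∧ x + 1 ≤ a + b ∧ 0 ≤ j ∧ j + 1 ≤ a + c ∧ -(b : ℤ) ≤ j - x ∧ j + 1 - x ≤ c) ∧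
      j ∈ S x := by
  classical
  rw [tilingOf, mem_filter, triPair_mem_lozenges, mem_hexagon_false, mem_hexagon_true]
  simp only [triPair_inj]
  constructor
  · rintro ⟨h, x', j', h' | h' | h'⟩
    · obtain rfl : x = x' := by omega
      obtain rfl : j = j' := by omega
      exact ⟨by omega, h'.2⟩
    · omega
    · omega
  · rintro ⟨h, h'⟩
    exact ⟨⟨by omega, by omega, by simp⟩, x, j, Or.inl ⟨by omega, h'⟩⟩

lemma lower_mem_tilingOf {x : ℕ} {j : ℤ} : triPair x j x j ∈ tilingOf a b c S ↔
    (x + 1 ≤ a + b ∧ 0 ≤ j ∧ j + 1 ≤ a + c ∧ 1 - (b : ℤ) ≤ j - x ∧ j + 1 - x ≤ c) ∧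
      countLE (S (x + 1)) j = countLE (S x) (j - 1) := by
  classical
  rw [tilingOf, mem_filter, triPair_mem_lozenges, mem_hexagon_false, mem_hexagon_true]
  simp only [triPair_inj]
  constructor
  · rintro ⟨h, x', j', h' | h' | h'⟩
    · omega
    · obtain rfl : x = x' := by omega
      obtain rfl : j = j' := by omega
      exact ⟨by omega, h'.2⟩
    · omega
  · rintro ⟨h, h'⟩
    exact ⟨⟨by omega, by omega, by simp⟩, x, j, Or.inr (Or.inl ⟨by omega, h'⟩)⟩

lemma upper_mem_tilingOf {x : ℕ} {j : ℤ} : triPair x (j + 1) x j ∈ tilingOf a b c S ↔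
    (x + 1 ≤ a + b ∧ 0 ≤ j ∧ j + 2 ≤ a + c ∧ -(b : ℤ) ≤ j - x ∧ j + 1 - x ≤ c) ∧
      countLE (S (x + 1)) j = countLE (S x) j + 1 := by
  classical
  rw [tilingOf, mem_filter, triPair_mem_lozenges, mem_hexagon_false, mem_hexagon_true]
  simp only [triPair_inj]
  constructor
  · rintro ⟨h, x', j', h' | h' | h'⟩
    · omega
    · omega
    · obtain rfl : x = x' := by omega
      obtain rfl : j = j' := by omega
      exact ⟨by omega, h'.2⟩
  · rintro ⟨h, h'⟩
    exact ⟨⟨by omega, by omega, by simp⟩, x, j, Or.inr (Or.inr ⟨by omega, h'⟩)⟩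

/-- Interlacing leaves `countLE (S (x + 1)) j` a single value if j lies in row x, and otherwise
exactly two, one for each non-horizontal lozenge on the triangle `(x, j, true)`. The triangles `(x,
j, false)` are treated alike with row x + 1. At the boundary, the position bounds, the forced
positions and the end rows exclude the lozenges that would leave the hexagon. -/
lemma tilingOf_mem_tilings (hS : S ∈ patterns (a + b) (topRow a b c)) :
    tilingOf a b c S ∈ tilings a b c := by
  obtain ⟨htop, -, hcard, hint⟩ := (mem_patterns_iff (topRow_strictMono a b c)).1 hS
  classical
  refine mem_tilings.2 ⟨filter_subset _ _, fun i j hij => ?_, fun i j hij => ?_⟩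
  · rw [mem_hexagon_true] at hij
    lift i to ℕ using hij.1 with x
    have hx : x < a + b := by omega
    have i1 := hint x hx j
    have i2 := hint x hx (j + 1)
    have i3 := hint x hx (j - 1)
    have c1 := countLE_eq_add (S x) j
    have c2 := countLE_eq_add (S (x + 1)) j
    have c3 := countLE_eq_add (S (x + 1)) (j + 1)
    have f1 := mem_Ico_of_mem_patterns hS hx.le (y := j)
    have hzero : x = 0 → j ∉ S x := fun h0 hj => by
      have := hcard x hx.le
      rw [h0, card_eq_zero] at this
      simp [h0, this] at hj
    have f2 := mem_of_mem_patterns hS (x := x + 1) hx (y := j)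
    have f3 := mem_of_mem_patterns hS (x := x + 1) hx (y := j + 1)
    rw [add_sub_cancel_right] at c3 i2
    push_cast at f2 f3
    simp only [horizontal_mem_tilingOf, lower_mem_tilingOf, upper_mem_tilingOf]
    clear hint hcard htop hS
    grind
  · rw [mem_hexagon_false] at hij
    lift i to ℕ using hij.1 with x
    have hx : x < a + b := by omega
    have i1 := hint x hx j
    have i2 := hint x hx (j - 1)
    have c1 := countLE_eq_add (S x) j
    have c2 := countLE_eq_add (S (x + 1)) j
    have hH := horizontal_mem_tilingOf (a := a) (b := b) (c := c) (S := S) (x := x + 1) (j := j)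
    have hU := upper_mem_tilingOf (a := a) (b := b) (c := c) (S := S) (x := x) (j := j - 1)
    push_cast at hH
    rw [add_sub_cancel_right] at hH
    rw [sub_add_cancel] at hU
    have ftop : x + 1 = a + b → j ∉ S (x + 1) := fun h => by
      rw [h, htop, mem_image_topRow]
      omega
    have hlow : countLE (S (x + 1)) (-1) = 0 :=
      countLE_eq_zero.2 fun y hy => by
        have := mem_Ico_of_mem_patterns hS (x := x + 1) hx hy
        omega
    have hup : j = c + x → countLE (S (x + 1)) j = x + 1 := fun h => by
      rw [countLE_eq_card.2, hcard _ hx]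
      intro y hy
      have := mem_Ico_of_mem_patterns hS (x := x + 1) hx hy
      push_cast at this
      omega
    have hup' : countLE (S x) (j - 1) ≤ x := (countLE_le_card _ _).trans (hcard x hx.le).le
    simp only [hH, lower_mem_tilingOf, hU]
    clear hint hcard htop hS
    grind

lemma rows_tilingOf (hS : S ∈ patterns (a + b) (topRow a b c)) :
    rows a b c (tilingOf a b c S) = S := by
  obtain ⟨htop, hbig, hcard, -⟩ := (mem_patterns_iff (topRow_strictMono a b c)).1 hS
  ext x y
  rw [mem_rows, horizontal_mem_tilingOf]
  rcases le_or_gt x (a + b) with hx | hx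
  · have f1 := mem_Ico_of_mem_patterns hS hx (y := y)
    have f2 := mem_of_mem_patterns hS hx (y := y)
    have hzero : x = 0 → y ∉ S x := fun h0 hj => by
      have := hcard x hx
      rw [h0, card_eq_zero] at this
      simp [h0, this] at hj
    have ftop : x = a + b → y ∈ S x → 0 ≤ y ∧ y < a ∨ a + c ≤ y ∧ y < a + b + c := fun h => by
      rw [h, htop, mem_image_topRow]
      exact id
    grind
  · rw [hbig x hx]
    simp
    omega

/-! ### Expectations over tilings as sums over patterns -/

lemma sum_tilings_rows (F : (ℕ → Finset ℤ) → ℝ) :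
    ∑ T ∈ tilings a b c, F (rows a b c T) = ∑ S ∈ patterns (a + b) (topRow a b c), F S :=
  sum_bij (fun T _ => rows a b c T) (fun _ hT => rows_mem_patterns hT)
    (fun _ hT _ hT' h => (subset_of_rows_eq hT hT' h).antisymm (subset_of_rows_eq hT' hT h.symm))
    (fun S hS => ⟨tilingOf a b c S, tilingOf_mem_tilings hS, rows_tilingOf hS⟩) (fun _ _ => rfl)

lemma sum_horizontalLozenge (hT : T ∈ tilings a b c) {x : ℕ}
    (hxN : x < a + b) (φ : ℤ → ℝ) :
    ∑ y ∈ Icc (0 : ℤ) (a + c - 1), (if horizontalLozenge x y ∈ T then φ y else 0)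
      = ∑ y ∈ rows a b c T x, φ y - ∑ y ∈ Ico (0 : ℤ) (x - b), φ y
        - ∑ y ∈ Ico ((a : ℤ) + c) (c + x), φ y := by
  have hset : rows a b c T x = ((Icc (0 : ℤ) (a + c - 1)).filter (horizontalLozenge x · ∈ T) ∪
      Ico (0 : ℤ) (x - b)) ∪ Ico ((a : ℤ) + c) (c + x) := by
    ext y
    have := triPair_mem_tiling hT (i := x - 1) (j := y) (i' := x) (j' := y)
    rw [mem_rows, mem_union, mem_union, mem_filter, mem_Icc, mem_Ico, mem_Ico, horizontalLozenge_eq]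
    grind
  rw [hset, sum_union, sum_union, sum_filter]
  · ring
  · rw [disjoint_left]
    intro y hy
    rw [mem_filter, horizontalLozenge_eq] at hy
    have := triPair_mem_tiling hT hy.2
    rw [mem_Ico]
    omega
  · rw [disjoint_left]
    intro y hy
    rw [mem_union, mem_filter, mem_Icc, mem_Ico] at hy
    rw [mem_Ico]
    omega

lemma card_tilings (a b c : ℕ) :
    ((tilings a b c).card : ℝ) = chooseDet Fin.val (topRow a b c) := by
  rw [← card_patterns _ (topRow_strictMono a b c)]
  simpa using sum_tilings_rows (a := a) (b := b) (c := c) fun _ => 1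

lemma chooseDet_topRow_ne_zero (a b c : ℕ) : chooseDet Fin.val (topRow a b c) ≠ 0 := by
  rw [← card_patterns _ (topRow_strictMono a b c), Nat.cast_ne_zero, card_ne_zero]
  exact patterns_nonempty _ (topRow_strictMono a b c)

lemma sum_P_mul {x : ℕ} (hxN : x < a + b) (φ : ℤ → ℝ) :
    ∑ y ∈ Icc (0 : ℤ) (a + c - 1), P a b c x y * φ y
      = (∑ S ∈ patterns (a + b) (topRow a b c), ∑ y ∈ S x, φ y) /
          chooseDet Fin.val (topRow a b c)
        - ∑ y ∈ Ico (0 : ℤ) (x - b), φ y - ∑ y ∈ Ico ((a : ℤ) + c) (c + x), φ y := by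
  have hV := chooseDet_topRow_ne_zero a b c
  have h : ∀ y, P a b c x y * φ y = (∑ T ∈ tilings a b c,
      if horizontalLozenge x y ∈ T then φ y else 0) / chooseDet Fin.val (topRow a b c) := by
    intro y
    rw [P, card_tilings, ← sum_filter, sum_const, nsmul_eq_mul]
    ring
  simp_rw [h]
  rw [← sum_div, sum_comm, sum_congr rfl fun T hT => sum_horizontalLozenge hT hxN φ,
    sum_sub_distrib, sum_sub_distrib, sum_tilings_rows (fun S => ∑ y ∈ S x, φ y), sum_const,
    sum_const, nsmul_eq_mul, nsmul_eq_mul, card_tilings]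
  field_simp

/-! ### Polynomial sums and the general quadratic moment -/

lemma sum_Ico_eq_sum_range (p : ℤ) (t : ℕ) (φ : ℤ → ℝ) :
    ∑ y ∈ Ico p (p + t), φ y = ∑ i ∈ range t, φ (p + i) := by
  induction t with
  | zero => simp
  | succ t ih =>
    rw [sum_range_succ, ← ih, Nat.cast_succ, ← add_assoc,
      ← insert_Ico_right_eq_Ico_add_one (by omega), sum_insert (by simp)]
    ring

lemma sum_range_sq (u s : ℝ) (t : ℕ) : ∑ i ∈ range t, (u * i + s) ^ 2
    = u ^ 2 * (t * (t - 1) * (2 * t - 1) / 6) + u * s * (t * (t - 1)) + s ^ 2 * t := by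
  induction t with
  | zero => simp
  | succ t ih => rw [sum_range_succ, ih]; push_cast; ring

lemma sum_range_cubic (p q r : ℝ) (n : ℕ) :
    ∑ t ∈ range n, (p * (t : ℝ) ^ 3 + q * (t : ℝ) ^ 2 + r * t)
      = p * (n * (n - 1) / 2) ^ 2 + q * (n * (n - 1) * (2 * n - 1) / 6) + r * (n * (n - 1) / 2) := by
  induction n with
  | zero => simp
  | succ n ih => rw [sum_range_succ, ih]; push_cast; ring

lemma sum_range_sum_Ico (m n : ℕ) (p : ℤ) (F : ℕ → ℤ → ℝ) :
    ∑ k ∈ range (m + n), ∑ y ∈ Ico p (p + k - m), F k y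
      = ∑ t ∈ range n, ∑ i ∈ range t, F (m + t) (p + i) := by
  rw [sum_range_add, sum_eq_zero, zero_add]
  · refine sum_congr rfl fun t _ => ?_
    rw [← sum_Ico_eq_sum_range p t (F (m + t))]
    congr 2
    push_cast
    ring
  · intro k hk
    rw [Ico_eq_empty, sum_empty]
    have := mem_range.1 hk
    omega

lemma sum_range_sum_range_sq (u v w : ℝ) (n : ℕ) :
    ∑ t ∈ range n, ∑ i ∈ range t, (u * i + (v * t + w)) ^ 2
      = (u ^ 2 / 3 + u * v + v ^ 2) * (n * (n - 1) / 2) ^ 2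
        + (-u ^ 2 / 2 + u * (w - v) + 2 * v * w) * (n * (n - 1) * (2 * n - 1) / 6)
        + (u ^ 2 / 6 - u * w + w ^ 2) * (n * (n - 1) / 2) := by
  rw [← sum_range_cubic]
  refine sum_congr rfl fun t _ => ?_
  rw [sum_range_sq]
  ring

lemma sum_topRow (a b c : ℕ) :
    ∑ i, (topRow a b c i : ℝ) = ((a : ℝ) + b) * (a + b - 1) / 2 + b * c := by
  have h : ∀ i : Fin (a + b), (topRow a b c i : ℝ)
      = (fun k : ℕ => if k < a then (k : ℝ) else c + k) i := by
    intro i; simp only [topRow]; split_ifs <;> push_cast <;> rfl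
  simp_rw [h]
  rw [Fin.sum_univ_eq_sum_range (fun k : ℕ => if k < a then (k : ℝ) else c + k), sum_range_add,
    sum_congr rfl fun k hk => if_pos (mem_range.1 hk)]
  have h1 := sum_range_cubic 0 0 1 a
  have h2 := sum_range_cubic 0 0 1 b
  simp [sum_add_distrib] at h1 h2 ⊢
  rw [h1, h2]
  ring

lemma sum_topRow_sq (a b c : ℕ) :
    ∑ i, (topRow a b c i : ℝ) ^ 2 = ((a : ℝ) + b) * (a + b - 1) * (2 * (a + b) - 1) / 6
      + c * (2 * a * b + b * (b - 1)) + b * c ^ 2 := by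
  have h : ∀ i : Fin (a + b), (topRow a b c i : ℝ) ^ 2
      = (fun k : ℕ => if k < a then (k : ℝ) ^ 2 else (c + k) ^ 2) i := by
    intro i; simp only [topRow]; split_ifs <;> push_cast <;> rfl
  simp_rw [h]
  rw [Fin.sum_univ_eq_sum_range (fun k : ℕ => if k < a then (k : ℝ) ^ 2 else (c + k) ^ 2),
    sum_range_add, sum_congr rfl fun k hk => if_pos (mem_range.1 hk)]
  have h1 := sum_range_sq 1 0 a
  have h2 := sum_range_sq 1 (c + a) b
  simp only [add_lt_iff_neg_left, not_lt_zero, if_false]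
  simp only [one_mul, add_zero] at h1 h2
  rw [h1, sum_congr rfl fun k _ => show ((c : ℝ) + (a + k : ℕ)) ^ 2 = (k + (c + a)) ^ 2 by
    push_cast; ring, h2]
  ring

/-- Both moments are instances of this one. The first double sum is the value for rows {0, …, k -
1}, the next two remove the forced corner triangles, and the multiple of b c comes from the three
raised determinants. -/
lemma sum_sum_P_mul_sq (ha : 0 < a) (hb : 0 < b) (u v w : ℝ) :
    ∑ x ∈ Icc (1 : ℤ) (a + b - 1), ∑ y ∈ Icc (0 : ℤ) (a + c - 1),
        P a b c x y * (u * y + (v * x + w)) ^ 2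
      = ∑ t ∈ range (a + b), ∑ i ∈ range t, (u * i + (v * t + w)) ^ 2
        - ∑ t ∈ range a, ∑ i ∈ range t, (u * i + (v * t + (v * b + w))) ^ 2
        - ∑ t ∈ range b, ∑ i ∈ range t, (u * i + (v * t + (u * (a + c) + v * a + w))) ^ 2
        + b * c * (u ^ 2 * ((a + b - 1) * (4 * (a + b) - 5) / 6
            + (b + 1) * (c - 1) * (a + b - 1) / 6 - (b - 1) * (c + 1) * (a + b - 2) / 6)
          + u * (v * (a + b - 1) * (2 * (a + b) - 1) / 3 + w * (a + b - 1))) := by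
  have hIcc : ∀ F : ℤ → ℝ, ∑ x ∈ Icc (1 : ℤ) (a + b - 1), F x = ∑ k ∈ Ico 1 (a + b), F k := by
    intro F
    refine sum_nbij' Int.toNat (fun k => (k : ℤ)) ?_ ?_ ?_ ?_ ?_ <;> intro x hx <;>
      simp only [mem_Icc, mem_Ico] at * <;> grind
  have hV := chooseDet_topRow_ne_zero a b c
  have hmono := topRow_strictMono a b c
  set V := chooseDet Fin.val (topRow a b c) with hVdef
  -- g, h and κ are the ratios of the determinants of shapes (1), (2) and (1, 1) to V.
  obtain ⟨g, hg⟩ : ∃ g, chooseDet (expOne (a + b)) (topRow a b c) = g * V :=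
    ⟨_, (div_mul_cancel₀ _ hV).symm⟩
  obtain ⟨h, hh⟩ : ∃ h, chooseDet (expTwo (a + b)) (topRow a b c) = h * V :=
    ⟨_, (div_mul_cancel₀ _ hV).symm⟩
  obtain ⟨κ, hκ⟩ : ∃ κ, chooseDet (expOneOne (a + b)) (topRow a b c) = κ * V :=
    ⟨_, (div_mul_cancel₀ _ hV).symm⟩
  have e1 : ((a : ℝ) + b) * g = b * c := by
    have := sum_mul_chooseDet_val (a + b) (topRow a b c)
    rw [sum_topRow, hg, ← hVdef] at this
    apply mul_right_cancel₀ hV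
    push_cast at this
    linear_combination -this
  have e2 : ((a : ℝ) + b) * (a + b + 1) * h - (a + b) * (a + b - 1) * κ = b * c * (c - b) := by
    have := sum_sq_mul_chooseDet_val (a + b) (topRow a b c)
    rw [sum_topRow_sq, hg, hh, hκ, ← hVdef] at this
    apply mul_right_cancel₀ hV
    push_cast at this
    linear_combination -this - (2 * (a + b) - 1) * V * e1
  -- The two power sums fix g and only one combination of h and κ; multiplying the determinant of
  -- shape (1) by the first power sum gives a second one.
  have e3 : ((a : ℝ) + b) * (a + b + 1) * h + (a + b) * (a + b - 1) * κ = b * c * (b * c - 1) := by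
    have := sum_mul_chooseDet_expOne (n := a + b) (by omega) (topRow a b c)
    rw [sum_topRow, hg, hh, hκ] at this
    apply mul_right_cancel₀ hV
    push_cast at this
    linear_combination -(a + b : ℝ) * this + (b * c - 1) * V * e1
  -- The zero cubic term and the redundant `0 + k - b` and `a + c + k - a` match the forms of
  -- `sum_range_cubic` and `sum_range_sum_Ico`.
  have hrow : ∀ k ∈ Ico 1 (a + b), ∑ y ∈ Icc (0 : ℤ) (a + c - 1),
      P a b c (k : ℤ) y * (u * y + (v * (k : ℤ) + w)) ^ 2
      = (∑ i ∈ range k, (u * i + (v * k + w)) ^ 2 + (0 * (k : ℝ) ^ 3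
          + (u ^ 2 * (2 * g + h - κ) + 2 * u * v * g) * (k : ℝ) ^ 2
          + (u ^ 2 * (-g + h + κ) + 2 * u * w * g) * k))
        - ∑ y ∈ Ico (0 : ℤ) (0 + k - b), (u * y + (v * k + w)) ^ 2
        - ∑ y ∈ Ico ((a : ℤ) + c) (a + c + k - a), (u * y + (v * k + w)) ^ 2 := by
    intro k hk
    rw [mem_Ico] at hk
    rw [sum_P_mul hk.2 fun y => (u * y + (v * (k : ℤ) + w)) ^ 2]
    have hcard : ∑ S ∈ patterns (a + b) (topRow a b c), ((S k).card : ℝ) = k * V := by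
      rw [hVdef, ← card_patterns _ hmono, mul_comm, ← nsmul_eq_mul, ← sum_const]
      refine sum_congr rfl fun S hS => ?_
      rw [((mem_patterns_iff hmono).1 hS).2.2.1 k hk.2.le]
    have hsq : ∑ S ∈ patterns (a + b) (topRow a b c), ∑ y ∈ S k, (u * y + (v * (k : ℤ) + w)) ^ 2
        = u ^ 2 * ∑ S ∈ patterns (a + b) (topRow a b c), ∑ y ∈ S k, (y : ℝ) ^ 2
          + 2 * u * (v * k + w) * ∑ S ∈ patterns (a + b) (topRow a b c), ∑ y ∈ S k, (y : ℝ)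
          + (v * k + w) ^ 2 * ∑ S ∈ patterns (a + b) (topRow a b c), ((S k).card : ℝ) := by
      simp only [mul_sum, ← sum_add_distrib]
      refine sum_congr rfl fun S _ => ?_
      rw [mul_comm _ ((S k).card : ℝ), ← nsmul_eq_mul, ← sum_const, ← sum_add_distrib]
      refine sum_congr rfl fun y _ => ?_
      push_cast
      ring
    rw [hsq, hcard, sum_patterns_sum_sq_row hk.1 hk.2.le hmono,
      sum_patterns_sum_row hk.1 hk.2.le hmono, hg, hh, hκ, ← hVdef, sum_range_sq]
    have e : (a : ℤ) + c + k - a = c + k := by ring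
    rw [e, zero_add]
    push_cast
    field_simp
    ring
  -- The row formula is available for k ≥ 1 only, but its right-hand side vanishes at k = 0.
  have hzero : ∀ f : ℕ → ℝ, f 0 = 0 → ∑ k ∈ Ico 1 (a + b), f k = ∑ k ∈ range (a + b), f k := by
    intro f hf
    rw [range_eq_Ico, sum_eq_sum_Ico_succ_bot (a := 0) (by omega), hf, zero_add]
  rw [hIcc, sum_congr rfl hrow, hzero]
  · rw [sum_sub_distrib, sum_sub_distrib, sum_add_distrib, sum_range_cubic]
    have hlow := sum_range_sum_Ico b a 0 fun k y => (u * y + (v * k + w)) ^ 2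
    have hhigh := sum_range_sum_Ico a b (a + c) fun k y => (u * y + (v * k + w)) ^ 2
    rw [add_comm b a] at hlow
    rw [hlow, hhigh]
    have r1 : ∀ t i : ℕ, (u * ((0 + i : ℤ) : ℝ) + (v * (b + t : ℕ) + w)) ^ 2
        = (u * i + (v * t + (v * b + w))) ^ 2 := by
      intro t i; push_cast; ring
    have r2 : ∀ t i : ℕ, (u * ((a + c + i : ℤ) : ℝ) + (v * (a + t : ℕ) + w)) ^ 2
        = (u * i + (v * t + (u * (a + c) + v * a + w))) ^ 2 := by
      intro t i; push_cast; ring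
    simp only [r1, r2]
    push_cast
    -- With N = a + b, summing h (k² + k) - κ (k² - k) over k < N gives (N - 1)/3 · N (N + 1) h - (N
    -- - 2)/3 · N (N - 1) κ, which is (2 N - 3)/6 times the left side of `e2` plus 1/6 times that of
    -- `e3`.
    linear_combination (u ^ 2 * (a + b - 1) * (4 * (a + b) - 5) / 6
      + u * (v * (a + b - 1) * (2 * (a + b) - 1) / 3 + w * (a + b - 1))) * e1
      + u ^ 2 * ((2 * (a + b) - 3) / 6) * e2 + u ^ 2 / 6 * e3
  · rw [Ico_eq_empty (by omega), Ico_eq_empty (by omega)]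
    simp

end LozengeTiling

theorem theorem1 (a b c : ℕ) (ha : 0 < a) (hb : 0 < b) (hc : 0 < c) :
    (∑ x ∈ Finset.Icc (1 : ℤ) (a + b - 1), ∑ y ∈ Finset.Icc (0 : ℤ) (a + c - 1),
        LozengeTiling.P a b c x y * ((x : ℝ) - ((a : ℝ) + b) / 2) ^ 2
      = 1 / 12 * (a : ℝ) * b * ((a : ℝ) ^ 2 + (b : ℝ) ^ 2 - 2)) ∧
    (∑ y ∈ Finset.Icc (0 : ℤ) (a + c - 1), ∑ x ∈ Finset.Icc (1 : ℤ) (a + b - 1),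
        LozengeTiling.P a b c x y *
          (2 * ((y : ℝ) - ((a : ℝ) + c - 1) / 2) - ((x : ℝ) - ((a : ℝ) + b) / 2)) ^ 2
      = 1 / 12 * (a : ℝ) * b *
          ((a : ℝ) ^ 2 + (b : ℝ) ^ 2 - 2 + 4 * (c : ℝ) ^ 2 + 4 * (a : ℝ) * c + 4 * (b : ℝ) * c)) := by
  constructor
  -- With u = 0 all three ratios drop out: only the number of lozenges on each vertical line
  -- matters.
  · have h := LozengeTiling.sum_sum_P_mul_sq (c := c) ha hb 0 1 (-((a : ℝ) + b) / 2)
    simp only [LozengeTiling.sum_range_sum_range_sq] at h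
    rw [Finset.sum_congr rfl fun x _ => Finset.sum_congr rfl fun y _ => ?_, h]
    · push_cast
      ring
    · ring
  · rw [Finset.sum_comm]
    have h := LozengeTiling.sum_sum_P_mul_sq (c := c) ha hb 2 (-1)
      (((a : ℝ) + b) / 2 - (a + c - 1))
    simp only [LozengeTiling.sum_range_sum_range_sq] at h
    rw [Finset.sum_congr rfl fun x _ => Finset.sum_congr rfl fun y _ => ?_, h]
    · push_cast
      ring
    · ring
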